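/- A family $(A_i)_{i\in I}$ of sets of integers is called a Sidon system if $A_i+A_j=A_{i'}+A_{j'}$ (equality of sumsets) implies $\{i,j\}=\{i',j'\}$. For integers $N>k\ge 1$ let $F_k(N)$ denote the largest cardinality of a Sidon system consisting of $k$-element subsets of $\{1,2,\dots,N\}$. Then: 1. $F_2(N)=2N-3$ for every integer $N>2$. 2. $F_3(N)\ge N^2/2-O(N)$; that is, there is a constant $C$ such that $F_3(N)\ge N^2/2-CN$ for every integer $N>3$. 3. For every integer $k\ge 4$, $F_k(N)=\Omega_k(N^{k-1})$; that is, there is a constant $c_k>0$ depending only on $k$ such that $F_k(N)\ge c_k N^{k-1}$ for every integer $N>k$. -/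

import Mathlib

open scoped Pointwise

/-- A family `(A i)` of sets of integers is a Sidon system if `A i + A j = A i' + A j'`
(equality of sumsets) forces `{i, j} = {i', j'}`. -/
def IsSidonSystem {ι : Type*} (A : ι → Set ℤ) : Prop :=
  ∀ i j i' j' : ι, A i + A j = A i' + A j' → ({i, j} : Set ι) = {i', j'}

/-- The `k`-element subsets of `[N] = {1, …, N}`. -/
noncomputable def kSubsets (k N : ℕ) : Finset (Finset ℤ) :=
  (Finset.Icc (1 : ℤ) (N : ℤ)).powersetCard k

open Classical in
/-- `sidonF k N` is the largest cardinality of a Sidon system consisting of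
`k`-element subsets of `{1, …, N}`: the maximum of `𝒜.card` over the finitely many families
`𝒜` of `k`-subsets of `{1, …, N}` which, indexed by their own members, are Sidon systems. -/
noncomputable def sidonF (k N : ℕ) : ℕ :=
  ((kSubsets k N).powerset.filter
    (fun 𝒜 => IsSidonSystem (fun A : {A : Finset ℤ // A ∈ 𝒜} => ((A : Finset ℤ) : Set ℤ)))).sup
    Finset.card

/-- Membership in the sumset `{0, x, y} + {0, u, v}`. -/
def MemTripleSum (x y u v z : ℤ) : Prop :=
  z = 0 ∨ z = x ∨ z = y ∨ z = u ∨ z = v ∨ z = x + u ∨ z = x + v ∨ z = y + u ∨ z = y + v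

/-- A triple `{0, x, y}` that is not a dilate of `{0, 1, 2}`, `{0, 1, 3}` or `{0, 2, 3}`. -/
def GoodTriple (x y : ℤ) : Prop :=
  0 < x ∧ x < y ∧ y ≠ 2 * x ∧ y ≠ 3 * x ∧ 2 * y ≠ 3 * x

theorem GoodTriple.reflect {x y : ℤ} (h : GoodTriple x y) : GoodTriple (y - x) y := by
  unfold GoodTriple at *; omega

theorem memTripleSum_swap {x y u v z : ℤ} : MemTripleSum x y u v z ↔ MemTripleSum u v x y z := by
  unfold MemTripleSum; omega

theorem memTripleSum_reflect {x y u v z : ℤ} :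
    MemTripleSum (y - x) y (v - u) v z ↔ MemTripleSum x y u v (y + v - z) := by
  unfold MemTripleSum; omega

section
variable {x y u v x' y' u' v' : ℤ}

theorem tripleSum_max_eq (hS : GoodTriple x y) (hT : GoodTriple u v) (hS' : GoodTriple x' y')
    (hT' : GoodTriple u' v')
    (h : ∀ z, MemTripleSum x y u v z ↔ MemTripleSum x' y' u' v' z) : y + v = y' + v' := by
  have h1 := (h (y + v)).1 (by simp [MemTripleSum])
  have h2 := (h (y' + v')).2 (by simp [MemTripleSum])
  unfold GoodTriple MemTripleSum at *
  omega

theorem tripleSum_min_eq (hS : GoodTriple x y) (hT : GoodTriple u v) (hS' : GoodTriple x' y')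
    (hT' : GoodTriple u' v') (hxu : x ≤ u) (hxu' : x' ≤ u')
    (h : ∀ z, MemTripleSum x y u v z ↔ MemTripleSum x' y' u' v' z) : x = x' := by
  have h1 := (h x).1 (by simp [MemTripleSum])
  have h2 := (h x').2 (by simp [MemTripleSum])
  unfold GoodTriple MemTripleSum at *
  omega

theorem tripleSum_reflect (hm : y + v = y' + v')
    (h : ∀ z, MemTripleSum x y u v z ↔ MemTripleSum x' y' u' v' z) (z : ℤ) :
    MemTripleSum (y - x) y (v - u) v z ↔ MemTripleSum (y' - x') y' (v' - u') v' z := by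
  rw [memTripleSum_reflect, memTripleSum_reflect, hm, h]

/-- Both summands have the same least positive element. -/
theorem tripleSum_unique_of_eq (hS : GoodTriple x y) (hT : GoodTriple x v)
    (hS' : GoodTriple x' y') (hT' : GoodTriple u' v') (hxu' : x' ≤ u')
    (h : ∀ z, MemTripleSum x y x v z ↔ MemTripleSum x' y' u' v' z) :
    (x = x' ∧ y = y' ∧ x = u' ∧ v = v') ∨ (x = u' ∧ y = v' ∧ x = x' ∧ v = y') := by
  have hm := tripleSum_max_eq hS hT hS' hT' h
  obtain rfl := tripleSum_min_eq hS hT hS' hT' le_rfl hxu' h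
  have h1 := (h (2 * x)).1 (by simp [MemTripleSum, two_mul])
  have hu : u' = x := by
    by_contra hne
    have hu2 : u' = 2 * x ∨ v' = 2 * x := by unfold GoodTriple MemTripleSum at *; omega
    have h2 := (h (3 * x)).2 (by unfold MemTripleSum; omega)
    unfold GoodTriple MemTripleSum at *
    omega
  subst hu
  have h2 := (h y).1 (by simp [MemTripleSum])
  have h3 := (h v).1 (by simp [MemTripleSum])
  have h4 := (h y').2 (by simp [MemTripleSum])
  have h5 := (h v').2 (by simp [MemTripleSum])
  unfold GoodTriple MemTripleSum at *
  clear h h1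
  omega

/-- The least positive element and the least distance to the maximum both come from the first
summand, on both sides. -/
theorem tripleSum_unique_of_lt_of_lt (hS : GoodTriple x y) (hT : GoodTriple u v)
    (hT' : GoodTriple u' v) (hxu : x < u) (huu : u < u') (hgap' : y - x < v - u')
    (h : ∀ z, MemTripleSum x y u v z ↔ MemTripleSum x y u' v z) : False := by
  have h1 := (h u).1 (by simp [MemTripleSum])
  have hu : u = y := by unfold GoodTriple MemTripleSum at *; omega
  subst hu
  have h2 := (h (u' + u)).2 (by unfold MemTripleSum; omega)
  have h3 := (h (u' + x)).2 (by unfold MemTripleSum; omega)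
  have h4 := (h u').2 (by unfold MemTripleSum; omega)
  unfold GoodTriple MemTripleSum at *
  clear h h1
  have h5 : u' + u = v := by omega
  omega

/-- The least positive element comes from the first summand and the least distance to the
maximum from the second one, on both sides. -/
theorem tripleSum_unique_of_lt_of_gt {d : ℤ} (hS : GoodTriple x y) (hT : GoodTriple u (u + d))
    (hS' : GoodTriple x y') (hT' : GoodTriple u' (u' + d)) (hxu : x < u)
    (huu : u < u') (hgap : d < y - x) (hgap' : d < y' - x) (hm : y + u = y' + u')
    (h : ∀ z, MemTripleSum x y u (u + d) z ↔ MemTripleSum x y' u' (u' + d) z) : False := by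
  have h1 := (h u).1 (by simp [MemTripleSum])
  have hu : u = y' := by unfold GoodTriple MemTripleSum at *; omega
  subst hu
  obtain rfl : u' = y := by omega
  have h2 := (h (u + x)).1 (by unfold MemTripleSum; omega)
  have h3 := (h (u + d)).1 (by unfold MemTripleSum; omega)
  have h4 := (h (u' + d + x)).2 (by unfold MemTripleSum; omega)
  unfold GoodTriple MemTripleSum at *
  clear h h1
  have h5 : u + x = u' ∨ u + x = u' + d := by omega
  have h6 : u + d = u' ∨ u + d = u' + x := by omega
  clear h2 h3
  omega

/-- On the left the least positive element and the least distance to the maximum come from the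
same summand, on the right they do not. -/
theorem tripleSum_mixed_aux {d e e' : ℤ} (hS : GoodTriple x (x + d)) (hT : GoodTriple u (u + e))
    (hS' : GoodTriple x (x + e')) (hT' : GoodTriple u' (u' + d)) (hxu : x < u) (hxu' : x < u')
    (hde : d < e) (hde' : d < e') (hm : u + e = u' + e') (huu : u ≤ u')
    (h : ∀ z, MemTripleSum x (x + d) u (u + e) z ↔ MemTripleSum x (x + e') u' (u' + d) z) :
    False := by
  have h1 := (h u).1 (by simp [MemTripleSum])
  have h2 := (h (x + d)).1 (by simp [MemTripleSum])
  have h3 := (h (u + e)).1 (by simp [MemTripleSum])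
  clear h
  unfold GoodTriple MemTripleSum at *
  rcases huu.eq_or_lt with rfl | hlt
  · obtain rfl : e = e' := by omega
    clear h1
    have h4 : x + d = u := by omega
    subst h4
    omega
  · have h4 : u = x + e' := by omega
    clear h1
    omega

theorem tripleSum_mixed (hS : GoodTriple x y) (hT : GoodTriple u v)
    (hS' : GoodTriple x y') (hT' : GoodTriple u' v') (hxu : x < u) (hxu' : x < u')
    (hgap : y - x < v - u) (hgap' : v' - u' < y' - x)
    (h : ∀ z, MemTripleSum x y u v z ↔ MemTripleSum x y' u' v' z) : False := by
  have hm := tripleSum_max_eq hS hT hS' hT' h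
  have hr := tripleSum_reflect hm h
  have hd : y - x = v' - u' :=
    tripleSum_min_eq hS.reflect hT.reflect hT'.reflect hS'.reflect hgap.le hgap'.le
      fun z => (hr z).trans memTripleSum_swap
  obtain ⟨d, rfl⟩ : ∃ d, y = x + d := ⟨y - x, by ring⟩
  obtain ⟨e, rfl⟩ : ∃ e, v = u + e := ⟨v - u, by ring⟩
  obtain ⟨e', rfl⟩ : ∃ e', y' = x + e' := ⟨y' - x, by ring⟩
  obtain rfl : v' = u' + d := by linarith
  rcases le_total u u' with huu | huu
  · exact tripleSum_mixed_aux hS hT hS' hT' hxu hxu' (by linarith) (by linarith) (by linarith)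
      huu h
  · have hS2 := hS.reflect
    have hT2 := hT.reflect
    have hS2' := hS'.reflect
    have hT2' := hT'.reflect
    simp only [add_sub_cancel_left] at *
    rw [add_comm] at hS2 hT2 hS2' hT2'
    refine tripleSum_mixed_aux (x := d) (d := x) (u := e) (e := u) (u' := e') (e' := u')
      hS2 hT2 hT2' hS2' hgap hgap' hxu hxu' (by linarith) (by linarith) fun z => ?_
    rw [add_comm d x, add_comm e u, add_comm d u', add_comm e' x, hr z, memTripleSum_swap]

theorem tripleSum_unique_of_le (hS : GoodTriple x y) (hT : GoodTriple u v)
    (hS' : GoodTriple x' y') (hT' : GoodTriple u' v') (hxu : x ≤ u) (hxu' : x' ≤ u')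
    (h : ∀ z, MemTripleSum x y u v z ↔ MemTripleSum x' y' u' v' z) :
    (x = x' ∧ y = y' ∧ u = u' ∧ v = v') ∨ (x = u' ∧ y = v' ∧ u = x' ∧ v = y') := by
  have hm := tripleSum_max_eq hS hT hS' hT' h
  obtain rfl := tripleSum_min_eq hS hT hS' hT' hxu hxu' h
  have hr := tripleSum_reflect hm h
  rcases hxu.eq_or_lt with rfl | hlt
  · exact tripleSum_unique_of_eq hS hT hS' hT' hxu' h
  rcases hxu'.eq_or_lt with rfl | hlt'
  · have := tripleSum_unique_of_eq hS' hT' hS hT hxu fun z => (h z).symm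
    omega
  rcases lt_trichotomy (y - x) (v - u) with hg | hg | hg
  · rcases lt_trichotomy (y' - x) (v' - u') with hg' | hg' | hg'
    · have hd := tripleSum_min_eq hS.reflect hT.reflect hS'.reflect hT'.reflect hg.le hg'.le hr
      obtain rfl : y = y' := by omega
      obtain rfl : v = v' := by omega
      rcases lt_trichotomy u u' with huu | rfl | huu
      · exact (tripleSum_unique_of_lt_of_lt hS hT hT' hlt huu hg' h).elim
      · simp
      · exact (tripleSum_unique_of_lt_of_lt hS hT' hT hlt' huu hg fun z => (h z).symm).elim
    · have hT2' := hT'.reflect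
      rw [← hg'] at hT2' hr
      have := tripleSum_unique_of_eq hS'.reflect hT2' hS.reflect hT.reflect hg.le
        fun z => (hr z).symm
      omega
    · exact (tripleSum_mixed hS hT hS' hT' hlt hlt' hg hg' h).elim
  · have hT2 := hT.reflect
    rw [← hg] at hT2 hr
    rcases le_total (y' - x) (v' - u') with hg' | hg'
    · have := tripleSum_unique_of_eq hS.reflect hT2 hS'.reflect hT'.reflect hg' hr
      omega
    · have := tripleSum_unique_of_eq hS.reflect hT2 hT'.reflect hS'.reflect hg'
        fun z => (hr z).trans memTripleSum_swap
      omega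
  · rcases lt_trichotomy (y' - x) (v' - u') with hg' | hg' | hg'
    · exact (tripleSum_mixed hS' hT' hS hT hlt' hlt hg' hg fun z => (h z).symm).elim
    · have hT2' := hT'.reflect
      rw [← hg'] at hT2' hr
      have := tripleSum_unique_of_eq hS'.reflect hT2' hT.reflect hS.reflect hg.le
        fun z => (hr z).symm.trans memTripleSum_swap
      omega
    · have hd := tripleSum_min_eq hT.reflect hS.reflect hT'.reflect hS'.reflect hg.le hg'.le
        fun z => memTripleSum_swap.trans ((hr z).trans memTripleSum_swap)
      obtain ⟨d, rfl⟩ : ∃ d, v = u + d := ⟨v - u, by ring⟩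
      obtain rfl : v' = u' + d := by linarith
      rcases lt_trichotomy u u' with huu | rfl | huu
      · exact (tripleSum_unique_of_lt_of_gt hS hT hS' hT' hlt huu (by linarith) (by linarith)
          (by linarith) h).elim
      · left; omega
      · exact (tripleSum_unique_of_lt_of_gt hS' hT' hS hT hlt' huu (by linarith) (by linarith)
          (by linarith) fun z => (h z).symm).elim

/-- The sumset of two good triples determines the triples. -/
theorem tripleSum_unique (hS : GoodTriple x y) (hT : GoodTriple u v)
    (hS' : GoodTriple x' y') (hT' : GoodTriple u' v')
    (h : ∀ z, MemTripleSum x y u v z ↔ MemTripleSum x' y' u' v' z) :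
    (x = x' ∧ y = y' ∧ u = u' ∧ v = v') ∨ (x = u' ∧ y = v' ∧ u = x' ∧ v = y') := by
  rcases le_total x u with hxu | hxu <;> rcases le_total x' u' with hxu' | hxu'
  · exact tripleSum_unique_of_le hS hT hS' hT' hxu hxu' h
  · have := tripleSum_unique_of_le hS hT hT' hS' hxu hxu' fun z => (h z).trans memTripleSum_swap
    tauto
  · have := tripleSum_unique_of_le hT hS hS' hT' hxu hxu' fun z => memTripleSum_swap.trans (h z)
    tauto
  · have := tripleSum_unique_of_le hT hS hT' hS' hxu hxu'
      fun z => memTripleSum_swap.trans ((h z).trans memTripleSum_swap)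
    tauto

end

/-- A finite family of `k`-subsets of `[N]` whose sumsets determine the summands is a lower bound
for `sidonF k N`. -/
theorem card_le_sidonF {ι : Type*} {k N : ℕ} (s : Finset ι) (f : ι → Finset ℤ)
    (hf : ∀ i ∈ s, f i ∈ kSubsets k N)
    (hs : ∀ i ∈ s, ∀ j ∈ s, ∀ i' ∈ s, ∀ j' ∈ s,
      (∀ z : ℤ, (∃ a ∈ f i, ∃ b ∈ f j, a + b = z) ↔ ∃ a ∈ f i', ∃ b ∈ f j', a + b = z) →
      (i = i' ∧ j = j') ∨ (i = j' ∧ j = i')) :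
    s.card ≤ sidonF k N := by
  classical
  have hinj : Set.InjOn f s := by
    intro i hi j hj hij
    have := hs i hi i hi j hj j hj (by simp [hij])
    tauto
  rw [← Finset.card_image_of_injOn hinj]
  unfold sidonF
  refine Finset.le_sup (f := Finset.card) ?_
  rw [Finset.mem_filter, Finset.mem_powerset]
  refine ⟨Finset.image_subset_iff.2 hf, ?_⟩
  rintro ⟨_, hi⟩ ⟨_, hj⟩ ⟨_, hi'⟩ ⟨_, hj'⟩ h
  obtain ⟨i, mi, rfl⟩ := Finset.mem_image.1 hi
  obtain ⟨j, mj, rfl⟩ := Finset.mem_image.1 hj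
  obtain ⟨i', mi', rfl⟩ := Finset.mem_image.1 hi'
  obtain ⟨j', mj', rfl⟩ := Finset.mem_image.1 hj'
  have := hs i mi j mj i' mi' j' mj' fun z => by
    simpa [Set.mem_add] using Set.ext_iff.1 h z
  rcases this with ⟨rfl, rfl⟩ | ⟨rfl, rfl⟩
  · rfl
  · exact Set.pair_comm _ _

theorem one_le_sidonF {k N : ℕ} (h : k ≤ N) : 1 ≤ sidonF k N := by
  obtain ⟨A, hA⟩ : (kSubsets k N).Nonempty := by
    unfold kSubsets
    exact Finset.powersetCard_nonempty.2 (by simpa using h)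
  simpa using card_le_sidonF (Finset.univ : Finset Unit) (fun _ => A) (fun _ _ => hA)
    (fun i _ j _ i' _ j' _ _ => Or.inl ⟨rfl, rfl⟩)

theorem sidonF_two_lower {N : ℕ} (hN : 2 < N) : 2 * N - 3 ≤ sidonF 2 N := by
  classical
  set s : Finset (ℤ × ℤ) :=
    (Finset.Icc 2 (N : ℤ)).image (fun b => (1, b)) ∪
      (Finset.Icc 2 ((N : ℤ) - 1)).image (fun a => (a, (N : ℤ))) with hs
  have hmem : ∀ p ∈ s, 1 ≤ p.1 ∧ p.1 < p.2 ∧ p.2 ≤ N ∧ (p.1 = 1 ∨ p.2 = N) := by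
    rintro ⟨a, b⟩ h
    simp only [hs, Finset.mem_union, Finset.mem_image, Finset.mem_Icc, Prod.mk.injEq] at h
    rcases h with ⟨c, hc, rfl, rfl⟩ | ⟨c, hc, rfl, rfl⟩ <;> simp <;> omega
  have hcard : s.card = 2 * N - 3 := by
    rw [hs, Finset.card_union_of_disjoint, Finset.card_image_of_injective,
      Finset.card_image_of_injective]
    · simp only [Int.card_Icc]; omega
    · intro a b h; simpa using h
    · intro a b h; simpa using h
    · rw [Finset.disjoint_left]
      rintro ⟨a, b⟩ h1 h2
      simp only [Finset.mem_image, Finset.mem_Icc, Prod.mk.injEq] at h1 h2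
      obtain ⟨c, hc, rfl, rfl⟩ := h1
      obtain ⟨d, hd, h3, h4⟩ := h2
      omega
  rw [← hcard]
  refine card_le_sidonF s (fun p => {p.1, p.2}) ?_ ?_
  · intro p hp
    have := hmem p hp
    rw [kSubsets, Finset.mem_powersetCard]
    refine ⟨?_, Finset.card_pair (by omega)⟩
    intro z hz
    simp only [Finset.mem_insert, Finset.mem_singleton] at hz
    rw [Finset.mem_Icc]
    omega
  · rintro ⟨a, b⟩ h1 ⟨c, d⟩ h2 ⟨a', b'⟩ h1' ⟨c', d'⟩ h2' h
    replace h1 := hmem _ h1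
    replace h2 := hmem _ h2
    replace h1' := hmem _ h1'
    replace h2' := hmem _ h2'
    simp only [Finset.mem_insert, Finset.mem_singleton, exists_eq_or_imp, exists_eq_left] at h
    simp only [Prod.mk.injEq] at *
    have e1 := (h (a + c)).1 (by simp)
    have e2 := (h (a' + c')).2 (by simp)
    have e3 := (h (b + d)).1 (by simp)
    have e4 := (h (b' + d')).2 (by simp)
    have e5 := (h (a + d)).1 (by simp)
    clear h hmem hs hcard
    have e6 : a + c = a' + c' := by clear e3 e4 e5; omega
    have e7 : b + d = b' + d' := by clear e1 e2 e5; omega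
    clear e1 e2 e3 e4
    have e8 : a + d = a' + d' ∨ a + d = b' + c' := by omega
    clear e5
    rcases e8 with e8 | e8 <;> omega

theorem sidonF_two_upper {N : ℕ} (hN : 2 < N) : sidonF 2 N ≤ 2 * N - 3 := by
  classical
  unfold sidonF
  refine Finset.sup_le fun 𝒜 h𝒜 => ?_
  rw [Finset.mem_filter, Finset.mem_powerset] at h𝒜
  obtain ⟨hsub, hsid⟩ := h𝒜
  have hex : ∀ A : Finset ℤ, ∃ m d : ℤ, A ∈ 𝒜 → A = {m, m + d} ∧ 1 ≤ m ∧ 1 ≤ d ∧ m + d ≤ N := by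
    intro A
    by_cases hA : A ∈ 𝒜
    swap
    · exact ⟨0, 0, fun h => (hA h).elim⟩
    have h1 := hsub hA
    rw [kSubsets, Finset.mem_powersetCard] at h1
    obtain ⟨h1, h2⟩ := h1
    obtain ⟨a, b, hab, rfl⟩ := Finset.card_eq_two.1 h2
    have ha := Finset.mem_Icc.1 (h1 (Finset.mem_insert_self a {b}))
    have hb := Finset.mem_Icc.1 (h1 (Finset.mem_insert_of_mem (Finset.mem_singleton_self b)))
    rcases hab.lt_or_gt with h | h
    · exact ⟨a, b - a, fun _ => ⟨by simp, by omega, by omega, by omega⟩⟩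
    · exact ⟨b, a - b, fun _ => ⟨by simp [Finset.pair_comm], by omega, by omega, by omega⟩⟩
  choose m d hmd using hex
  -- `A` is counted by its shape if it is leftmost of that shape, otherwise by a shift.
  let first : Finset ℤ → Prop := fun A => ∀ B ∈ 𝒜, d B = d A → m A ≤ m B
  have hfirst : (𝒜.filter first).card ≤ N - 1 := by
    have : (𝒜.filter first).card ≤ (Finset.Icc (1 : ℤ) (N - 1)).card := by
      refine Finset.card_le_card_of_injOn d ?_ ?_
      · intro A hA
        have := hmd A (Finset.mem_filter.1 hA).1
        simp only [Finset.coe_Icc, Set.mem_Icc]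
        omega
      · intro A hA B hB hAB
        rw [Finset.mem_coe, Finset.mem_filter] at hA hB
        have hm : m A = m B := le_antisymm (hA.2 B hB.1 hAB.symm) (hB.2 A hA.1 hAB)
        rw [(hmd A hA.1).1, (hmd B hB.1).1, hm, hAB]
    simp only [Int.card_Icc] at this
    omega
  have hrest : (𝒜.filter fun A => ¬ first A).card ≤ N - 2 := by
    have hp : ∀ A : Finset ℤ, ∃ B, ¬ first A → B ∈ 𝒜 ∧ d B = d A ∧ m B < m A := by
      intro A
      by_cases h : first A
      · exact ⟨A, fun h' => (h' h).elim⟩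
      · simp only [first] at h
        push Not at h
        obtain ⟨B, h1, h2, h3⟩ := h
        exact ⟨B, fun _ => ⟨h1, h2, h3⟩⟩
    choose p hp using hp
    have : (𝒜.filter fun A => ¬ first A).card ≤ (Finset.Icc (1 : ℤ) (N - 2)).card := by
      refine Finset.card_le_card_of_injOn (fun A => m A - m (p A)) ?_ ?_
      · intro A hA
        rw [Finset.mem_coe, Finset.mem_filter] at hA
        obtain ⟨h1, h2, h3⟩ := hp A hA.2
        have := hmd A hA.1
        have := hmd _ h1
        simp only [Finset.coe_Icc, Set.mem_Icc]
        omega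
      · intro A hA B hB hAB
        rw [Finset.mem_coe, Finset.mem_filter] at hA hB
        obtain ⟨h1, h2, h3⟩ := hp A hA.2
        obtain ⟨h1', h2', h3'⟩ := hp B hB.2
        have hsum : (A : Set ℤ) + ((p B : Finset ℤ) : Set ℤ) =
            ((p A : Finset ℤ) : Set ℤ) + (B : Set ℤ) := by
          have e1 := (hmd A hA.1).1
          have e2 := (hmd B hB.1).1
          have e3 := (hmd _ h1).1
          have e4 := (hmd _ h1').1
          have hAB' : m A - m (p A) = m B - m (p B) := hAB
          have hB' : m (p B) = m B - m A + m (p A) := by omega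
          clear hAB hAB'
          generalize p A = A' at *
          generalize p B = B' at *
          rw [h2] at e3
          rw [h2'] at e4
          generalize m A = a, m B = b, m A' = a', m B' = b', d A = c, d B = e at *
          subst e1 e2 e3 e4 hB'
          ext z
          simp only [Set.mem_add, Finset.coe_insert, Finset.coe_singleton, Set.mem_insert_iff,
            Set.mem_singleton_iff, exists_eq_or_imp, exists_eq_left]
          omega
        have := hsid ⟨A, hA.1⟩ ⟨p B, h1'⟩ ⟨p A, h1⟩ ⟨B, hB.1⟩ hsum
        have hmem : (⟨A, hA.1⟩ : {A : Finset ℤ // A ∈ 𝒜}) ∈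
            ({⟨p A, h1⟩, ⟨B, hB.1⟩} : Set {A : Finset ℤ // A ∈ 𝒜}) := this ▸ Set.mem_insert _ _
        simp only [Set.mem_insert_iff, Set.mem_singleton_iff, Subtype.mk.injEq] at hmem
        rcases hmem with h | h
        · rw [← h] at h3; exact (lt_irrefl _ h3).elim
        · exact h
    simp only [Int.card_Icc] at this
    omega
  have := Finset.card_filter_add_card_filter_not (s := 𝒜) first
  omega

theorem sidonF_three_lower (N : ℕ) :
    (N : ℝ) ^ 2 / 2 - 5 * (N : ℝ) ≤ (sidonF 3 N : ℝ) := by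
  classical
  set s : Finset (Σ _ : ℕ, ℕ) :=
    (Finset.range N).sigma fun y => Finset.Ioo 0 y \ {y / 2, y / 3, 2 * y / 3} with hs
  have hmem : ∀ p ∈ s, GoodTriple p.2 p.1 ∧ p.1 < N := by
    rintro ⟨y, x⟩ h
    simp only [hs, Finset.mem_sigma, Finset.mem_range, Finset.mem_sdiff, Finset.mem_Ioo,
      Finset.mem_insert, Finset.mem_singleton] at h
    unfold GoodTriple
    dsimp only
    omega
  have hcard : (N : ℝ) ^ 2 / 2 - 5 * (N : ℝ) ≤ (s.card : ℝ) := by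
    have h1 : ∑ y ∈ Finset.range N, ((y : ℝ) - 4) ≤ (s.card : ℝ) := by
      rw [hs, Finset.card_sigma, Nat.cast_sum]
      refine Finset.sum_le_sum fun y _ => ?_
      have h2 := Finset.le_card_sdiff {y / 2, y / 3, 2 * y / 3} (Finset.Ioo 0 y)
      have h3 : ({y / 2, y / 3, 2 * y / 3} : Finset ℕ).card ≤ 3 := Finset.card_le_three
      rw [Nat.card_Ioo] at h2
      have h4 : y ≤ (Finset.Ioo 0 y \ {y / 2, y / 3, 2 * y / 3}).card + 4 := by omega
      have h5 : (y : ℝ) ≤ ((Finset.Ioo 0 y \ {y / 2, y / 3, 2 * y / 3}).card : ℝ) + 4 := by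
        exact_mod_cast h4
      linarith
    have h2 : ∑ y ∈ Finset.range N, ((y : ℝ) - 4) = (N : ℝ) ^ 2 / 2 - N / 2 - 4 * N := by
      clear h1 hmem hs s
      induction N with
      | zero => simp
      | succ n ih => rw [Finset.sum_range_succ, ih]; push_cast; ring
    have h3 : (0 : ℝ) ≤ N := N.cast_nonneg
    linarith
  refine hcard.trans (Nat.cast_le.2 ?_)
  refine card_le_sidonF s (fun p => {1, 1 + (p.2 : ℤ), 1 + (p.1 : ℤ)}) ?_ ?_
  · rintro ⟨y, x⟩ hp
    have := hmem _ hp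
    unfold GoodTriple at this
    dsimp only at this ⊢
    rw [kSubsets, Finset.mem_powersetCard]
    refine ⟨?_, Finset.card_eq_three.2 ⟨_, _, _, by omega, by omega, by omega, rfl⟩⟩
    intro z hz
    simp only [Finset.mem_insert, Finset.mem_singleton] at hz
    rw [Finset.mem_Icc]
    omega
  · rintro ⟨y, x⟩ h1 ⟨v, u⟩ h2 ⟨y', x'⟩ h1' ⟨v', u'⟩ h2' h
    have := tripleSum_unique (hmem _ h1).1 (hmem _ h2).1 (hmem _ h1').1 (hmem _ h2').1 fun z => by
      have := h (z + 2)
      simp only [Finset.mem_insert, Finset.mem_singleton, exists_eq_or_imp, exists_eq_left] at this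
      unfold MemTripleSum
      dsimp only
      constructor
      · intro hz
        have := this.1 (by omega)
        omega
      · intro hz
        have := this.2 (by omega)
        omega
    simp only [Nat.cast_inj] at this
    rcases this with ⟨rfl, rfl, rfl, rfl⟩ | ⟨rfl, rfl, rfl, rfl⟩ <;> simp

theorem four_pow_add_inj {i j p q : ℕ} (h : 4 ^ i + 4 ^ j = 4 ^ p + 4 ^ q) :
    (i = p ∧ j = q) ∨ (i = q ∧ j = p) := by
  have key : ∀ {i j p q : ℕ}, i ≤ j → p ≤ q → 4 ^ i + 4 ^ j = 4 ^ p + 4 ^ q → i = p ∧ j = q := by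
    intro i j p q hij hpq h
    have bound : ∀ {i j p q : ℕ}, i ≤ j → 4 ^ i + 4 ^ j = 4 ^ p + 4 ^ q → q ≤ j := by
      intro i j p q hij h
      by_contra! hlt
      have h1 : 4 ^ i ≤ 4 ^ j := Nat.pow_le_pow_right (by norm_num) hij
      have h2 : 4 ^ (j + 1) ≤ 4 ^ q := Nat.pow_le_pow_right (by norm_num) hlt
      have h3 : 0 < 4 ^ j := by positivity
      have h4 : 0 < 4 ^ p := by positivity
      rw [pow_succ] at h2
      omega
    obtain rfl : j = q := le_antisymm (bound hpq h.symm) (bound hij h)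
    exact ⟨Nat.pow_right_injective (le_refl 2 |>.trans (by norm_num)) (Nat.add_right_cancel h), rfl⟩
  rcases le_total i j with hij | hij <;> rcases le_total p q with hpq | hpq
  · exact Or.inl (key hij hpq h)
  · exact Or.inr (key hij hpq (by omega))
  · exact Or.inr (key hij hpq (by omega)).symm
  · exact Or.inl (key hij hpq (by omega)).symm

/-- Position of the `i`-th point of a lacunary set whose blocks have length `M`. -/
def blockPoint (M i r : ℕ) : ℕ := 2 * M * 4 ^ i + r

theorem blockPoint_add_inj {M i j p q r s r' s' : ℕ} (hr : r < M) (hs : s < M) (hr' : r' < M)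
    (hs' : s' < M)
    (h : blockPoint M i r + blockPoint M j s = blockPoint M p r' + blockPoint M q s') :
    ((i = p ∧ j = q) ∨ (i = q ∧ j = p)) ∧ r + s = r' + s' := by
  unfold blockPoint at h
  have h1 : (r + s) + 2 * M * (4 ^ i + 4 ^ j) = (r' + s') + 2 * M * (4 ^ p + 4 ^ q) := by
    linarith
  have h2 : r + s = r' + s' := by
    have := congrArg (· % (2 * M)) h1
    simpa [Nat.add_mul_mod_self_left, Nat.mod_eq_of_lt (show r + s < 2 * M by omega),
      Nat.mod_eq_of_lt (show r' + s' < 2 * M by omega)] using this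
  rw [h2] at h1
  exact ⟨four_pow_add_inj (Nat.eq_of_mul_eq_mul_left (by omega) (Nat.add_left_cancel h1)), h2⟩

/-- Two functions vanishing at `0` are determined by the values `f i + g j`, each known up to
exchanging `i` and `j`. -/
theorem eq_or_swap_of_crossSums {ι : Type*} (o : ι) {f g f' g' : ι → ℕ}
    (hf : f o = 0) (hg : g o = 0) (hf' : f' o = 0)
    (h : ∀ i j, f i + g j = f' i + g' j ∨ f i + g j = f' j + g' i)
    (h' : ∀ i j, f' i + g' j = f i + g j ∨ f' i + g' j = f j + g i) :
    (f = f' ∧ g = g') ∨ (f = g' ∧ g = f') := by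
  have hpt : ∀ i, (f i = f' i ∧ g i = g' i) ∨ (f i = g' i ∧ g i = f' i) := by
    intro i
    have := h i o
    have := h o i
    have := h' i o
    have := h' o i
    have := h i i
    omega
  by_cases hall : ∀ i, f i = f' i ∧ g i = g' i
  · exact Or.inl ⟨funext fun i => (hall i).1, funext fun i => (hall i).2⟩
  · push Not at hall
    obtain ⟨i, hi⟩ := hall
    right
    have : ∀ j, f j = g' j ∧ g j = f' j := by
      intro j
      have := hpt i
      have := hpt j
      have := h i j
      have := h j i
      by_cases f i = f' i <;> omega
    exact ⟨funext fun i => (this i).1, funext fun i => (this i).2⟩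

theorem pow_le_sidonF {n M N : ℕ} (hM : 0 < M) (h : 4 ^ (n + 1) * M ≤ N) : M ^ n ≤ sidonF (n + 1) N := by
  classical
  let e : (Fin n → Fin M) → Fin (n + 1) → ℕ := fun f => Fin.cons 0 fun i => (f i : ℕ)
  have he0 : ∀ f, e f 0 = 0 := fun f => rfl
  have hinj : Function.Injective e := by
    intro f g hfg
    funext i
    have := congrFun hfg i.succ
    simpa [e, Fin.ext_iff] using this
  have hlt : ∀ f i, e f i < M := by
    intro f i
    refine Fin.cases ?_ (fun i => ?_) i
    · exact hM
    · exact (f i).2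
  let A : (Fin n → Fin M) → Finset ℤ := fun f =>
    Finset.univ.image fun i : Fin (n + 1) => ((1 + blockPoint M i (e f i) : ℕ) : ℤ)
  have key : ∀ f g f' g' : Fin n → Fin M,
      (∀ z : ℤ, (∃ a ∈ A f, ∃ b ∈ A g, a + b = z) → ∃ a ∈ A f', ∃ b ∈ A g', a + b = z) →
      ∀ i j, e f i + e g j = e f' i + e g' j ∨ e f i + e g j = e f' j + e g' i := by
    intro f g f' g' hz i j
    obtain ⟨_, ha, _, hb, hab⟩ := hz _ ⟨_, Finset.mem_image_of_mem _ (Finset.mem_univ i), _,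
      Finset.mem_image_of_mem _ (Finset.mem_univ j), rfl⟩
    obtain ⟨p, -, rfl⟩ := Finset.mem_image.1 ha
    obtain ⟨q, -, rfl⟩ := Finset.mem_image.1 hb
    have h1 : blockPoint M p (e f' p) + blockPoint M q (e g' q) =
        blockPoint M i (e f i) + blockPoint M j (e g j) := by
      have : (1 + blockPoint M p (e f' p)) + (1 + blockPoint M q (e g' q)) =
        (1 + blockPoint M i (e f i)) + (1 + blockPoint M j (e g j)) := by exact_mod_cast hab
      omega
    obtain ⟨h2, h3⟩ := blockPoint_add_inj (hlt _ _) (hlt _ _) (hlt _ _) (hlt _ _) h1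
    rcases h2 with ⟨hp, hq⟩ | ⟨hp, hq⟩
    · obtain rfl := Fin.ext hp
      obtain rfl := Fin.ext hq
      exact Or.inl h3.symm
    · obtain rfl := Fin.ext hp
      obtain rfl := Fin.ext hq
      exact Or.inr h3.symm
  have := card_le_sidonF (k := n + 1) (N := N) (Finset.univ : Finset (Fin n → Fin M)) A ?_ ?_
  · simpa using this
  · intro f _
    rw [kSubsets, Finset.mem_powersetCard]
    constructor
    · intro z hz
      obtain ⟨i, -, rfl⟩ := Finset.mem_image.1 hz
      have h1 : 4 ^ (i : ℕ) ≤ 4 ^ n := Nat.pow_le_pow_right (by norm_num) (by omega)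
      have h2 : M * 4 ^ (i : ℕ) ≤ M * 4 ^ n := Nat.mul_le_mul_left _ h1
      have h3 : M ≤ M * 4 ^ n := Nat.le_mul_of_pos_right _ (by positivity)
      have h4 : 4 ^ (n + 1) * M = 4 * (M * 4 ^ n) := by ring
      have h5 : 2 * M * 4 ^ (i : ℕ) = 2 * (M * 4 ^ (i : ℕ)) := by ring
      have := hlt f i
      rw [Finset.mem_Icc]
      unfold blockPoint
      constructor
      · exact_mod_cast Nat.le_add_right 1 _
      · exact_mod_cast (by omega : 1 + (2 * M * 4 ^ (i : ℕ) + e f i) ≤ N)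
    · rw [Finset.card_image_of_injective, Finset.card_univ, Fintype.card_fin]
      intro i j hij
      have hij' : blockPoint M i (e f i) = blockPoint M j (e f j) := by
        have : 1 + blockPoint M i (e f i) = 1 + blockPoint M j (e f j) := Int.ofNat_inj.1 hij
        omega
      have := (blockPoint_add_inj (hlt f i) (hlt f i) (hlt f j) (hlt f j)
        (congrArg₂ (· + ·) hij' hij')).1
      exact Fin.ext (by omega)
  · intro f _ g _ f' _ g' _ hz
    have := eq_or_swap_of_crossSums 0 (he0 f) (he0 g) (he0 f')
      (key f g f' g' fun z => (hz z).1) (key f' g' f g fun z => (hz z).2)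
    simpa only [hinj.eq_iff] using this

theorem sidonF_lower {k : ℕ} (hk : 4 ≤ k) : ∃ c : ℝ, 0 < c ∧
    ∀ N : ℕ, k < N → c * (N : ℝ) ^ (k - 1) ≤ (sidonF k N : ℝ) := by
  obtain ⟨n, rfl⟩ : ∃ n, k = n + 1 := ⟨k - 1, by omega⟩
  simp only [Nat.add_sub_cancel]
  have hL : (0 : ℝ) < 2 * 4 ^ (n + 1) := by positivity
  refine ⟨(1 / (2 * 4 ^ (n + 1))) ^ n, by positivity, fun N hN => ?_⟩
  rw [← mul_pow, one_div_mul_eq_div]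
  rcases lt_or_ge N (4 ^ (n + 1)) with hlt | hge
  · have h1 : (N : ℝ) < 4 ^ (n + 1) := by exact_mod_cast hlt
    have h2 : (N : ℝ) / (2 * 4 ^ (n + 1)) ≤ 1 :=
      (div_le_one hL).2 (by linarith [N.cast_nonneg (α := ℝ)])
    exact (pow_le_one₀ (by positivity) h2).trans (by exact_mod_cast one_le_sidonF hN.le)
  · have hM : 1 ≤ N / 4 ^ (n + 1) := (Nat.one_le_div_iff (by positivity)).2 hge
    have h1 : N < 4 ^ (n + 1) * (N / 4 ^ (n + 1) + 1) := Nat.lt_mul_div_succ N (by positivity)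
    have h2 : N ≤ 2 * 4 ^ (n + 1) * (N / 4 ^ (n + 1)) := by nlinarith
    have h3 : (N : ℝ) ≤ 2 * 4 ^ (n + 1) * ((N / 4 ^ (n + 1) : ℕ) : ℝ) := by exact_mod_cast h2
    calc ((N : ℝ) / (2 * 4 ^ (n + 1))) ^ n ≤ ((N / 4 ^ (n + 1) : ℕ) : ℝ) ^ n := by
          gcongr
          rwa [div_le_iff₀' hL]
      _ ≤ (sidonF (n + 1) N : ℝ) := by exact_mod_cast pow_le_sidonF hM (Nat.mul_div_le N _)

theorem theorem2 :
    (∀ N : ℕ, 2 < N → (sidonF 2 N : ℤ) = 2 * (N : ℤ) - 3) ∧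
    (∃ C : ℝ, ∀ N : ℕ, 3 < N → (N : ℝ) ^ 2 / 2 - C * (N : ℝ) ≤ (sidonF 3 N : ℝ)) ∧
    (∀ k : ℕ, 4 ≤ k → ∃ c : ℝ, 0 < c ∧
      ∀ N : ℕ, k < N → c * (N : ℝ) ^ (k - 1) ≤ (sidonF k N : ℝ)) := by
  refine ⟨fun N hN => ?_, ⟨5, fun N _ => sidonF_three_lower N⟩, fun k hk => sidonF_lower hk⟩
  have h1 := sidonF_two_lower hN
  have h2 := sidonF_two_upper hN
  omega
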